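/- **Theorem 3.3.** Let $\Bbbk$ be a field, $S=\Bbbk[x_1,x_2,x_3]$ (also written $\Bbbk[x,y,z]$), $\mathfrak m=(x_1,x_2,x_3)$, and let $I=(m_1,\dots,m_n)$ be an $\mathfrak m$-primary monomial ideal of $S$, minimally generated by the monomials $m_1,\dots,m_n$. Put $R=S/I$, let $K=K(x_1,x_2,x_3;R)$ be the Koszul complex, i.e. the exterior algebra on $R^3=Re_1\oplus Re_2\oplus Re_3$ with the differential that is the antiderivation with $e_i\mapsto x_i$, and let $A=H(K)$ be its homology algebra, $A_i=H_i(K)$. Let $Z_2\subseteq S^n$ be the kernel of $S^n\to S$, $e_s\mapsto m_s$, and for $1\le s<t\le n$ let $$\sigma_{st}=\frac{m_{st}}{m_t}\,e_t-\frac{m_{st}}{m_s}\,e_s\in Z_2,\qquad m_{st}=\operatorname{lcm}(m_s,m_t).$$ Order these by $\sigma_{kl}<\sigma_{st}$ if $k<s$, or $k=s$ and $l<t$. Call $\sigma_{kl}$ an *ordered minimal second syzygy*, $\sigma_{kl}\in S_2$, if 1. $\sigma_{kl}\in Z_2\setminus\mathfrak m Z_2$, and 2. $\sigma_{kl}$ cannot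 be written as $\sum_{s<t}a_{st}\sigma_{st}$ with $a_{st}\in S$ such that $\sigma_{kl}<\sigma_{st}$ for all $s<t$ with $a_{st}\notin\mathfrak m$ (that is, with $a_{st}$ a unit of $S_{\mathfrak m}$). Let $1\le k<l\le n$ and $i,j\in\{1,2,3\}$ be such that $x_i\mid m_k$, $x_j\mid m_l$, and the classes of $\frac{m_k}{x_i}e_i$ and $\frac{m_l}{x_j}e_j$ are minimal generators of $A_1$ (each belongs to some minimal generating set of the $R$-module $A_1$). Then the product of these two classes in $A_1^2\subseteq A_2$ is nonzero if and only if $\sigma_{kl}\in S_2$ and every nonzero entry of $\sigma_{kl}$ lies in $I$. -/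

import Mathlib

noncomputable section

/-! ### The Koszul complex and the Koszul homology algebra -/

section Koszul

variable {R : Type*} [CommRing R] {r : ℕ}

/-- The differential `∂` of the Koszul complex `K(x₁, …, x_r; R)`, whose underlying graded algebra
is the exterior algebra of the free module `R^r`: the contraction with the linear form
`e_i ↦ x_i`.  It is the antiderivation with `∂ (e_i) = x_i`, that is
`∂ (e_i ∧ b) = x_i b - e_i ∧ ∂ b`. -/
def koszulD (x : Fin r → R) :
    ExteriorAlgebra R (Fin r → R) →ₗ[R] ExteriorAlgebra R (Fin r → R) :=
  CliffordAlgebra.contractLeft (Q := (0 : QuadraticForm R (Fin r → R)))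
    (Fintype.linearCombination R x)

theorem koszulD_ι_mul (x : Fin r → R) (v : Fin r → R) (b : ExteriorAlgebra R (Fin r → R)) :
    koszulD x (ExteriorAlgebra.ι R v * b) =
      (Fintype.linearCombination R x v) • b - ExteriorAlgebra.ι R v * koszulD x b :=
  CliffordAlgebra.contractLeft_ι_mul _ v b

theorem koszulD_ι (x : Fin r → R) (v : Fin r → R) :
    koszulD x (ExteriorAlgebra.ι R v) =
      algebraMap R (ExteriorAlgebra R (Fin r → R)) (Fintype.linearCombination R x v) :=
  CliffordAlgebra.contractLeft_ι _ _ v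

theorem koszulD_algebraMap (x : Fin r → R) (c : R) :
    koszulD x (algebraMap R (ExteriorAlgebra R (Fin r → R)) c) = 0 :=
  CliffordAlgebra.contractLeft_algebraMap _ _ c

theorem koszulD_koszulD (x : Fin r → R) (a : ExteriorAlgebra R (Fin r → R)) :
    koszulD x (koszulD x a) = 0 :=
  CliffordAlgebra.contractLeft_contractLeft _ a

/-- The involution of the exterior algebra acting as `(-1)^i` in degree `i`. -/
def koszulSign : ExteriorAlgebra R (Fin r → R) →ₐ[R] ExteriorAlgebra R (Fin r → R) :=
  CliffordAlgebra.involute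

theorem koszulSign_ι (v : Fin r → R) :
    koszulSign (ExteriorAlgebra.ι R v) = -ExteriorAlgebra.ι R v :=
  CliffordAlgebra.involute_ι v

theorem koszulSign_koszulSign (a : ExteriorAlgebra R (Fin r → R)) :
    koszulSign (koszulSign a) = a :=
  CliffordAlgebra.involute_involute a

/-- The Leibniz rule. -/
theorem koszulD_mul (x : Fin r → R) (a b : ExteriorAlgebra R (Fin r → R)) :
    koszulD x (a * b) = koszulD x a * b + koszulSign a * koszulD x b := by
  induction a using CliffordAlgebra.left_induction with
  | algebraMap c =>
    have h1 := koszulD_algebraMap x c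
    have h2 : koszulSign (algebraMap R (ExteriorAlgebra R (Fin r → R)) c) =
      algebraMap R _ c := AlgHom.commutes _ c
    change koszulD x (algebraMap R (ExteriorAlgebra R (Fin r → R)) c * b) =
      koszulD x (algebraMap R (ExteriorAlgebra R (Fin r → R)) c) * b +
        koszulSign (algebraMap R (ExteriorAlgebra R (Fin r → R)) c) * koszulD x b
    rw [h1, h2, ← Algebra.smul_def, ← Algebra.smul_def, map_smul, zero_mul, zero_add]
  | add a₁ a₂ h₁ h₂ =>
    simp only [add_mul, map_add, h₁, h₂]
    abel
  | ι_mul a v h =>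
    change koszulD x (ExteriorAlgebra.ι R v * a * b) =
      koszulD x (ExteriorAlgebra.ι R v * a) * b +
        koszulSign (ExteriorAlgebra.ι R v * a) * koszulD x b
    rw [mul_assoc, koszulD_ι_mul, koszulD_ι_mul, h, map_mul, koszulSign_ι]
    simp only [sub_mul, smul_mul_assoc, mul_add, neg_mul, mul_assoc]
    abel

theorem koszulD_koszulSign (x : Fin r → R) (a : ExteriorAlgebra R (Fin r → R)) :
    koszulD x (koszulSign a) = -koszulSign (koszulD x a) := by
  induction a using CliffordAlgebra.left_induction with
  | algebraMap c =>
    have h1 := koszulD_algebraMap x c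
    have h2 : koszulSign (algebraMap R (ExteriorAlgebra R (Fin r → R)) c) =
      algebraMap R _ c := AlgHom.commutes _ c
    change koszulD x (koszulSign (algebraMap R (ExteriorAlgebra R (Fin r → R)) c)) =
      -koszulSign (koszulD x (algebraMap R (ExteriorAlgebra R (Fin r → R)) c))
    rw [h2, h1, map_zero, neg_zero]
  | add a₁ a₂ h₁ h₂ =>
    simp only [map_add, h₁, h₂]
    abel
  | ι_mul a v h =>
    change koszulD x (koszulSign (ExteriorAlgebra.ι R v * a)) =
      -koszulSign (koszulD x (ExteriorAlgebra.ι R v * a))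
    rw [map_mul, koszulSign_ι, neg_mul, map_neg, koszulD_ι_mul, koszulD_ι_mul, h, map_sub,
      map_smul, map_mul, koszulSign_ι]
    simp

/-- The algebra of cycles of the Koszul complex. -/
def koszulCycles (x : Fin r → R) : Subalgebra R (ExteriorAlgebra R (Fin r → R)) where
  carrier := {a | koszulD x a = 0}
  mul_mem' {a b} ha hb := by
    have ha' : koszulD x a = 0 := ha
    have hb' : koszulD x b = 0 := hb
    change koszulD x (a * b) = 0
    rw [koszulD_mul, ha', hb', zero_mul, mul_zero, add_zero]
  add_mem' {a b} ha hb := by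
    have ha' : koszulD x a = 0 := ha
    have hb' : koszulD x b = 0 := hb
    change koszulD x (a + b) = 0
    rw [map_add, ha', hb', add_zero]
  algebraMap_mem' c := koszulD_algebraMap x c

/-- The ideal of boundaries in the algebra of cycles. -/
def koszulBoundaries (x : Fin r → R) : Ideal (koszulCycles x) where
  carrier := {a | ∃ w, koszulD x w = a}
  zero_mem' := ⟨0, map_zero _⟩
  add_mem' := by
    rintro a b ⟨v, hv⟩ ⟨w, hw⟩
    exact ⟨v + w, by rw [map_add, hv, hw]; rfl⟩
  smul_mem' := by
    rintro c a ⟨w, hw⟩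
    have hc : koszulD x c = 0 := c.2
    refine ⟨koszulSign c * w, ?_⟩
    rw [koszulD_mul, koszulD_koszulSign, hc, map_zero, neg_zero, zero_mul, zero_add,
      koszulSign_koszulSign, hw]
    rfl

instance koszulBoundaries_isTwoSided (x : Fin r → R) : (koszulBoundaries x).IsTwoSided where
  mul_mem_of_left := by
    rintro a b ⟨w, hw⟩
    have hb : koszulD x b = 0 := b.2
    refine ⟨w * b, ?_⟩
    rw [koszulD_mul, hb, mul_zero, add_zero, hw]
    rfl

/-- The Koszul homology algebra `A = H(K(x₁, …, x_r; R))`: cycles modulo boundaries, with the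
product induced by the exterior product. -/
abbrev KoszulHomology (x : Fin r → R) : Type _ :=
  koszulCycles x ⧸ koszulBoundaries x

/-- The homology class of a cycle. -/
def koszulClass (x : Fin r → R) (z : ExteriorAlgebra R (Fin r → R)) (hz : koszulD x z = 0) :
    KoszulHomology x :=
  Ideal.Quotient.mk (koszulBoundaries x) ⟨z, hz⟩

/-- The degree `i` component `A_i = H_i(K)` of the Koszul homology algebra: the classes of the
cycles lying in `⋀^i R^r`. -/
def koszulHomologyDegree (x : Fin r → R) (i : ℕ) : Submodule R (KoszulHomology x) where
  carrier := {a | ∃ z, ∃ hz : koszulD x z = 0, z ∈ ⋀[R]^i (Fin r → R) ∧ koszulClass x z hz = a}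
  zero_mem' := ⟨0, map_zero _, Submodule.zero_mem _, map_zero (Ideal.Quotient.mk _)⟩
  add_mem' := by
    rintro _ _ ⟨v, hv, hv', rfl⟩ ⟨w, hw, hw', rfl⟩
    exact ⟨v + w, (koszulCycles x).add_mem hv hw, Submodule.add_mem _ hv' hw', rfl⟩
  smul_mem' := by
    rintro c _ ⟨v, hv, hv', rfl⟩
    exact ⟨c • v, (koszulCycles x).smul_mem hv c, Submodule.smul_mem _ c hv', rfl⟩

end Koszul

/-- `a` is a minimal generator of the submodule `N`: it belongs to a generating set of `N` of which
no proper subset generates `N`. -/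
def IsMinimalGenerator {R M : Type*} [Semiring R] [AddCommMonoid M] [Module R M]
    (N : Submodule R M) (a : M) : Prop :=
  ∃ s : Set M, Submodule.span R s = N ∧ (∀ t, t ⊂ s → Submodule.span R t ≠ N) ∧ a ∈ s

/-! ### Monomial ideals of `S = 𝕜[x, y, z]`

The monomials `m_1, …, m_n` are given by their exponent vectors `m : Fin n → (Fin 3 →₀ ℕ)`, and
`x, y, z` are `X 0, X 1, X 2`. -/

section Monomial

variable (𝕜 : Type*) [Field 𝕜] {n : ℕ} (m : Fin n → (Fin 3 →₀ ℕ))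

/-- The polynomial ring `S = 𝕜[x, y, z]`. -/
abbrev TriPoly : Type _ := MvPolynomial (Fin 3) 𝕜

/-- The monomial with exponent vector `d`. -/
def triMon (d : Fin 3 →₀ ℕ) : TriPoly 𝕜 := MvPolynomial.monomial d 1

/-- The homogeneous maximal ideal `𝔪 = (x, y, z)`. -/
abbrev homMaxIdeal : Ideal (TriPoly 𝕜) := MvPolynomial.idealOfVars (Fin 3) 𝕜

/-- The monomial ideal `I = (m_1, …, m_n)`. -/
def monIdeal : Ideal (TriPoly 𝕜) := Ideal.span (Set.range fun s => triMon 𝕜 (m s))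

/-- `m_1, …, m_n` is a minimal generating system of `I`: no `m_s` can be omitted. -/
def IsMinimallyGenerating : Prop :=
  ∀ s, triMon 𝕜 (m s) ∉ Ideal.span ((fun t => triMon 𝕜 (m t)) '' {t | t ≠ s})

/-- `R = S / I`. -/
abbrev MonQuot : Type _ := TriPoly 𝕜 ⧸ monIdeal 𝕜 m

/-- The images of the variables `x, y, z` in `R = S / I`. -/
def quotVars : Fin 3 → MonQuot 𝕜 m := fun i => Ideal.Quotient.mk _ (MvPolynomial.X i)

/-- The element `(m_k / x_i) e_i` of degree one of the Koszul complex `K(x, y, z; R)`; it is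
meant for `x_i` dividing `m_k`. -/
def koszulGen (k : Fin n) (i : Fin 3) :
    ExteriorAlgebra (MonQuot 𝕜 m) (Fin 3 → MonQuot 𝕜 m) :=
  ExteriorAlgebra.ι (MonQuot 𝕜 m)
    (Pi.single i (Ideal.Quotient.mk (monIdeal 𝕜 m) (triMon 𝕜 (m k - Finsupp.single i 1))))

theorem koszulD_koszulGen (k : Fin n) (i : Fin 3) (h : m k i ≠ 0) :
    koszulD (quotVars 𝕜 m) (koszulGen 𝕜 m k i) = 0 := by
  have hle : Finsupp.single i 1 ≤ m k := by
    rw [Finsupp.single_le_iff]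
    exact Nat.one_le_iff_ne_zero.mpr h
  have hmem : triMon 𝕜 (m k) ∈ monIdeal 𝕜 m := Ideal.subset_span ⟨k, rfl⟩
  have hmul : triMon 𝕜 (m k - Finsupp.single i 1) * MvPolynomial.X i = triMon 𝕜 (m k) := by
    rw [triMon, triMon, MvPolynomial.X, MvPolynomial.monomial_mul, tsub_add_cancel_of_le hle,
      one_mul]
  have hzero : Ideal.Quotient.mk (monIdeal 𝕜 m) (triMon 𝕜 (m k - Finsupp.single i 1)) *
      quotVars 𝕜 m i = 0 := by
    rw [quotVars, ← map_mul, hmul]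
    exact Ideal.Quotient.eq_zero_iff_mem.mpr hmem
  rw [koszulGen, koszulD_ι, Fintype.linearCombination_apply_single, smul_eq_mul, hzero, map_zero]

/-- The class of `(m_k / x_i) e_i` in `A_1 = H_1(K)`, for `x_i` dividing `m_k`. -/
def koszulGenClass (k : Fin n) (i : Fin 3) (h : m k i ≠ 0) : KoszulHomology (quotVars 𝕜 m) :=
  koszulClass (quotVars 𝕜 m) (koszulGen 𝕜 m k i) (koszulD_koszulGen 𝕜 m k i h)

/-! ### Second syzygies -/

/-- The module `Z₂ ⊆ S^n` of second syzygies of `S / I`, that is of relations on the generators: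
the kernel of `S^n → S`, `e_s ↦ m_s`. -/
def secondSyzygies : Submodule (TriPoly 𝕜) (Fin n → TriPoly 𝕜) :=
  LinearMap.ker (Fintype.linearCombination (TriPoly 𝕜) fun s => triMon 𝕜 (m s))

/-- `σ_{kl} = (m_{kl} / m_l) e_l - (m_{kl} / m_k) e_k`, where `m_{kl} = lcm (m_k, m_l)`. -/
def syz (k l : Fin n) : Fin n → TriPoly 𝕜 :=
  Pi.single l (triMon 𝕜 (m k ⊔ m l - m l)) - Pi.single k (triMon 𝕜 (m k ⊔ m l - m k))

/-- `σ_{kl}` (with `k < l`) is an ordered minimal second syzygy, `σ_{kl} ∈ S₂`: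
(1) `σ_{kl} ∈ Z₂ \ 𝔪 Z₂`, and
(2) `σ_{kl}` is not a combination `∑_{s < t} a_{st} σ_{st}` in which every `σ_{st}` whose
coefficient is a unit comes strictly after `σ_{kl}` in the dictionary order.
As usual for minimal resolutions, a unit is a unit of the local ring `S_𝔪`, that is an element
outside `𝔪`; for homogeneous coefficients this is the same as a unit of `S`. -/
def IsOrderedMinimalSyzygy (k l : Fin n) : Prop :=
  syz 𝕜 m k l ∈ secondSyzygies 𝕜 m ∧
  syz 𝕜 m k l ∉ homMaxIdeal 𝕜 • secondSyzygies 𝕜 m ∧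
  ¬ ∃ a : Fin n → Fin n → TriPoly 𝕜,
      syz 𝕜 m k l = ∑ s, ∑ t ∈ Finset.Ioi s, a s t • syz 𝕜 m s t ∧
      ∀ s t, s < t → a s t ∉ homMaxIdeal 𝕜 → k < s ∨ (k = s ∧ l < t)

end Monomial

end

/-!
Write `L = m_k m_l`. Both sides of the equivalence are shown to amount to one combinatorial
condition: `m_k` and `m_l` are coprime and no generator of `I` divides `L / (x_p x_q)` with
`x_p ∣ m_k` and `x_q ∣ m_l`.

*Koszul side.* The class of `(m_k / x_p) e_p` does not depend on the variable `x_p ∣ m_k`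
(`koszulGenClass_eq`), so the product is represented by `L / (x_p x_q) e_p ∧ e_q` for every choice
of `p` and `q`; it vanishes if `p = q` is possible or if some `L / (x_p x_q)` lies in `I`
(`support_disjoint_and_not_le_of_mul_ne_zero`). Conversely, if the product is a boundary, taking
coordinates of the bounding chain by contracting with the dual basis shows that either
`L / (x_i x_j)` lies in `I`, or the third variable `x_h` divides `L` and both `L / (x_i x_h)` and
`L / (x_j x_h)` lie in `I` (`le_of_koszulGenClass_mul_eq_zero`). As `x_h` divides `m_k` or `m_l`,
one of these monomials is of the required form.

*Syzygy side.* By minimality of the generators, the entries of `σ_{kl}` lie in `I` exactly when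
`m_k` and `m_l` are coprime (`support_disjoint_of_syz_mem`). If a generator `m_s` divides
`L / (x_p x_q)`, then `σ_{kl}` is a combination of `σ_{ks}` and `σ_{sl}` with coefficients in `𝔪`
(`syz_mem_smul_secondSyzygies`). If there is no such generator, `m_k` and `m_l` are the only
generators dividing `L` (`eq_or_eq_of_le_add`); then the coefficient of `m_k` in the `l`-th
coordinate vanishes on `𝔪 Z₂` and on all multiples of the other `σ_{st}`, but not on `σ_{kl}`,
so that `σ_{kl}` is an ordered minimal second syzygy (`isOrderedMinimalSyzygy_of_not_le`).
-/

noncomputable section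

/-! ### Monomial ideals -/

section MonomialIdeal

variable {𝕜 : Type*} [Field 𝕜] {n : ℕ} {m : Fin n → (Fin 3 →₀ ℕ)}

theorem exists_le_of_mem_monIdeal {f : TriPoly 𝕜} (hf : f ∈ monIdeal 𝕜 m) {d : Fin 3 →₀ ℕ}
    (hd : MvPolynomial.coeff d f ≠ 0) : ∃ s, m s ≤ d := by
  have h : f ∈ Ideal.span ((fun e => MvPolynomial.monomial e (1 : 𝕜)) '' Set.range m) := by
    rw [← Set.range_comp]
    exact hf
  obtain ⟨_, ⟨s, rfl⟩, hs⟩ := MvPolynomial.mem_ideal_span_monomial_image.mp h d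
    (MvPolynomial.mem_support_iff.mpr hd)
  exact ⟨s, hs⟩

theorem triMon_mul (d e : Fin 3 →₀ ℕ) : triMon 𝕜 d * triMon 𝕜 e = triMon 𝕜 (d + e) := by
  rw [triMon, triMon, triMon, MvPolynomial.monomial_mul, one_mul]

theorem triMon_mem_of_le {J : Ideal (TriPoly 𝕜)} {d e : Fin 3 →₀ ℕ} (h : d ≤ e)
    (hd : triMon 𝕜 d ∈ J) : triMon 𝕜 e ∈ J := by
  rw [← tsub_add_cancel_of_le h, ← triMon_mul]
  exact J.mul_mem_left _ hd

theorem triMon_mem_monIdeal_iff {d : Fin 3 →₀ ℕ} :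
    triMon 𝕜 d ∈ monIdeal 𝕜 m ↔ ∃ s, m s ≤ d := by
  refine ⟨fun h => exists_le_of_mem_monIdeal h (d := d) ?_, ?_⟩
  · simp [triMon]
  · rintro ⟨s, hs⟩
    exact triMon_mem_of_le hs (Ideal.subset_span ⟨s, rfl⟩)

theorem IsMinimallyGenerating.eq_of_le (hmin : IsMinimallyGenerating 𝕜 m) {s t : Fin n}
    (h : m s ≤ m t) : s = t := by
  by_contra hst
  exact hmin t (triMon_mem_of_le h (Ideal.subset_span ⟨s, hst, rfl⟩))

theorem triMon_mul_X {d : Fin 3 →₀ ℕ} {i : Fin 3} (h : d i ≠ 0) :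
    triMon 𝕜 (d - Finsupp.single i 1) * MvPolynomial.X i = triMon 𝕜 d := by
  have hle : Finsupp.single i 1 ≤ d := by
    rw [Finsupp.single_le_iff]
    exact Nat.one_le_iff_ne_zero.mpr h
  rw [triMon, triMon, MvPolynomial.X, MvPolynomial.monomial_mul, tsub_add_cancel_of_le hle,
    one_mul]

theorem triMon_mem_homMaxIdeal {d : Fin 3 →₀ ℕ} (h : d ≠ 0) : triMon 𝕜 d ∈ homMaxIdeal 𝕜 := by
  obtain ⟨i, hi⟩ := Finsupp.ne_iff.mp h
  rw [← triMon_mul_X hi]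
  exact Ideal.mul_mem_left _ _ (Ideal.subset_span ⟨i, rfl⟩)

theorem coeff_zero_of_mem_homMaxIdeal {a : TriPoly 𝕜} (ha : a ∈ homMaxIdeal 𝕜) :
    MvPolynomial.coeff 0 a = 0 := by
  have h : homMaxIdeal 𝕜 ≤ RingHom.ker (MvPolynomial.constantCoeff (σ := Fin 3) (R := 𝕜)) := by
    refine Ideal.span_le.mpr ?_
    rintro _ ⟨i, rfl⟩
    simp
  exact h ha

/-- If `m_k`, `m_l` are coprime and no generator divides `m_k m_l / (x_p x_q)` with `x_p ∣ m_k`,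
`x_q ∣ m_l`, then no generator except `m_k` and `m_l` divides `m_k m_l`: a generator whose exponent
drops somewhere on the support of `m_l` has full exponent on the support of `m_k`. -/
theorem eq_or_eq_of_le_add (hmin : IsMinimallyGenerating 𝕜 m) {k l : Fin n}
    (hdisj : ∀ p, m k p = 0 ∨ m l p = 0)
    (hC : ∀ p q, m k p ≠ 0 → m l q ≠ 0 → ∀ s,
      ¬ m s ≤ (m k - Finsupp.single p 1) + (m l - Finsupp.single q 1))
    {s : Fin n} (hs : m s ≤ m k + m l) : s = k ∨ s = l := by
  by_cases hq : ∃ q, m l q ≠ 0 ∧ m s q < m l q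
  · obtain ⟨q, hq, hsq⟩ := hq
    refine Or.inl (hmin.eq_of_le fun p => ?_).symm
    by_contra! hp
    refine hC p q (by omega) hq s fun r => ?_
    have := hs r
    have := hdisj r
    simp only [Finsupp.coe_add, Finsupp.coe_tsub, Pi.add_apply, Pi.sub_apply,
      Finsupp.single_apply] at *
    split_ifs <;> subst_vars <;> omega
  · push Not at hq
    refine Or.inr (hmin.eq_of_le fun q => ?_).symm
    by_cases h : m l q = 0
    · simp [h]
    · exact hq q h

end MonomialIdeal

/-! ### Coordinates of boundaries in the Koszul complex -/

section Contraction

variable {R : Type*} [CommRing R] {r : ℕ}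

/-- Contraction of the exterior algebra with the `p`-th coordinate form. -/
def coordContract (p : Fin r) :
    ExteriorAlgebra R (Fin r → R) →ₗ[R] ExteriorAlgebra R (Fin r → R) :=
  CliffordAlgebra.contractLeft (Q := (0 : QuadraticForm R (Fin r → R))) (LinearMap.proj p)

theorem coordContract_comm (p q : Fin r) (a : ExteriorAlgebra R (Fin r → R)) :
    coordContract p (coordContract q a) = -coordContract q (coordContract p a) :=
  CliffordAlgebra.contractLeft_comm _ _ a

theorem coordContract_self (p : Fin r) (a : ExteriorAlgebra R (Fin r → R)) :
    coordContract p (coordContract p a) = 0 :=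
  CliffordAlgebra.contractLeft_contractLeft _ a

theorem coordContract_koszulD (x : Fin r → R) (p : Fin r)
    (a : ExteriorAlgebra R (Fin r → R)) :
    coordContract p (koszulD x a) = -koszulD x (coordContract p a) :=
  CliffordAlgebra.contractLeft_comm _ _ a

theorem koszulD_eq_sum (x : Fin r → R) (a : ExteriorAlgebra R (Fin r → R)) :
    koszulD x a = ∑ p, x p • coordContract p a := by
  have h : Fintype.linearCombination R x =
      ∑ p, x p • (LinearMap.proj p : (Fin r → R) →ₗ[R] R) := by
    ext v
    simp [Fintype.linearCombination_apply, mul_comm]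
  rw [koszulD, h, map_sum, LinearMap.sum_apply]
  refine Finset.sum_congr rfl fun p _ => ?_
  rw [map_smul]
  rfl

theorem coordContract_coordContract_ι_mul_ι (p q : Fin r) (v w : Fin r → R) :
    coordContract p (coordContract q (ExteriorAlgebra.ι R v * ExteriorAlgebra.ι R w)) =
      algebraMap R _ (v q * w p - w q * v p) := by
  have h1 : ∀ (a : Fin r) (u : Fin r → R) (b : ExteriorAlgebra R (Fin r → R)),
      coordContract a (ExteriorAlgebra.ι R u * b) =
        u a • b - ExteriorAlgebra.ι R u * coordContract a b :=
    fun a u b => CliffordAlgebra.contractLeft_ι_mul _ u b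
  have h2 : ∀ (a : Fin r) (u : Fin r → R),
      coordContract a (ExteriorAlgebra.ι R u) = algebraMap R _ (u a) :=
    fun a u => CliffordAlgebra.contractLeft_ι _ _ u
  rw [h1, h2, map_sub, map_smul, h2, ← Algebra.commutes, ← Algebra.smul_def, map_smul, h2,
    Algebra.smul_def, Algebra.smul_def, ← map_mul, ← map_mul, ← map_sub]

theorem koszulD_ι_single_mul_ι_single (x : Fin r → R) (p i : Fin r) (c : R) :
    koszulD x (ExteriorAlgebra.ι R (Pi.single p c) * ExteriorAlgebra.ι R (Pi.single i 1)) =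
      ExteriorAlgebra.ι R (Pi.single i (c * x p)) -
        ExteriorAlgebra.ι R (Pi.single p (c * x i)) := by
  have h1 : (Pi.single i (c * x p) : Fin r → R) = (c * x p) • Pi.single i 1 := by
    rw [← Pi.single_smul', smul_eq_mul, mul_one]
  have h2 : (Pi.single p (c * x i) : Fin r → R) = x i • Pi.single p c := by
    rw [← Pi.single_smul', smul_eq_mul, mul_comm]
  rw [koszulD_ι_mul, koszulD_ι, Fintype.linearCombination_apply_single,
    Fintype.linearCombination_apply_single, ← Algebra.commutes, ← Algebra.smul_def, h1, h2,
    map_smul, map_smul, smul_eq_mul, smul_eq_mul, one_mul]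

theorem ι_single_mul_ι_single_eq_zero {p q : Fin r} {a b : R} (hab : p = q ∨ a * b = 0) :
    ExteriorAlgebra.ι R (Pi.single p a : Fin r → R) * ExteriorAlgebra.ι R (Pi.single q b) = 0 := by
  have h : ∀ (t : Fin r) (c : R), (Pi.single t c : Fin r → R) = c • Pi.single t 1 := fun t c => by
    rw [← Pi.single_smul', smul_eq_mul, mul_one]
  rw [h p a, h q b, map_smul, map_smul, smul_mul_assoc, mul_smul_comm, smul_smul]
  rcases hab with rfl | hab
  · rw [ExteriorAlgebra.ι_sq_zero, smul_zero]
  · rw [hab, zero_smul]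

/-- In three variables, a boundary `∂ w` has `e_p ∧ e_q`-coordinate `x_h g` (up to sign), where `h`
is the third index and `g` the `e_p ∧ e_q ∧ e_h`-coordinate of `w`. -/
theorem coordContract_coordContract_koszulD (x : Fin 3 → R) {p q h : Fin 3} (hpq : p ≠ q)
    (hph : p ≠ h) (hqh : q ≠ h) (w : ExteriorAlgebra R (Fin 3 → R)) :
    coordContract p (coordContract q (koszulD x w)) =
      x h • coordContract h (coordContract p (coordContract q w)) := by
  have huniv : (Finset.univ : Finset (Fin 3)) = {p, q, h} := by
    revert p q h
    decide
  rw [coordContract_koszulD, map_neg, coordContract_koszulD, neg_neg, koszulD_eq_sum, huniv,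
    Finset.sum_insert (by simp [hpq, hph]), Finset.sum_insert (by simp [hqh]),
    Finset.sum_singleton, coordContract_self, coordContract_comm p q, map_neg,
    coordContract_self, neg_zero, smul_zero, smul_zero, zero_add, zero_add]

end Contraction

/-! ### Products of classes of degree one -/

section Product

variable {𝕜 : Type*} [Field 𝕜] {n : ℕ} {m : Fin n → (Fin 3 →₀ ℕ)}

theorem koszulClass_eq_iff {R : Type*} [CommRing R] {r : ℕ} {x : Fin r → R}
    {y z : ExteriorAlgebra R (Fin r → R)} (hy : koszulD x y = 0) (hz : koszulD x z = 0) :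
    koszulClass x y hy = koszulClass x z hz ↔ ∃ w, koszulD x w = y - z :=
  Ideal.Quotient.eq

theorem koszulGenClass_mul_eq_zero_iff {k l : Fin n} {i j : Fin 3} (hi : m k i ≠ 0)
    (hj : m l j ≠ 0) :
    koszulGenClass 𝕜 m k i hi * koszulGenClass 𝕜 m l j hj = 0 ↔
      ∃ w, koszulD (quotVars 𝕜 m) w = koszulGen 𝕜 m k i * koszulGen 𝕜 m l j := by
  rw [koszulGenClass, koszulGenClass, koszulClass, koszulClass, ← map_mul]
  exact Ideal.Quotient.eq_zero_iff_mem

/-- The class of `(m_k / x_p) e_p` is the same for all variables `x_p` dividing `m_k`: two of these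
cycles differ by the boundary of `m_k / (x_p x_i) e_p ∧ e_i`. -/
theorem koszulGenClass_eq {k : Fin n} {p i : Fin 3} (hp : m k p ≠ 0) (hi : m k i ≠ 0) :
    koszulGenClass 𝕜 m k i hi = koszulGenClass 𝕜 m k p hp := by
  by_cases hpi : p = i
  · subst hpi
    rfl
  refine (koszulClass_eq_iff _ _).mpr ?_
  set c : MonQuot 𝕜 m := Ideal.Quotient.mk (monIdeal 𝕜 m)
    (triMon 𝕜 (m k - Finsupp.single p 1 - Finsupp.single i 1)) with hc
  have h1 : c * quotVars 𝕜 m i =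
      Ideal.Quotient.mk (monIdeal 𝕜 m) (triMon 𝕜 (m k - Finsupp.single p 1)) := by
    rw [hc, quotVars, ← map_mul, triMon_mul_X]
    simp [hpi, hi]
  have h2 : c * quotVars 𝕜 m p =
      Ideal.Quotient.mk (monIdeal 𝕜 m) (triMon 𝕜 (m k - Finsupp.single i 1)) := by
    rw [hc, quotVars, ← map_mul, tsub_right_comm, triMon_mul_X]
    simp [Ne.symm hpi, hp]
  refine ⟨ExteriorAlgebra.ι _ (Pi.single p c) * ExteriorAlgebra.ι _ (Pi.single i 1), ?_⟩
  rw [koszulD_ι_single_mul_ι_single, h1, h2]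
  rfl

/-- A nonzero product forces `m_k`, `m_l` to be coprime and `m_k m_l / (x_p x_q) ∉ I` for all
variables `x_p ∣ m_k` and `x_q ∣ m_l`. -/
theorem support_disjoint_and_not_le_of_mul_ne_zero {k l : Fin n} {i j : Fin 3}
    (hi : m k i ≠ 0) (hj : m l j ≠ 0)
    (h : koszulGenClass 𝕜 m k i hi * koszulGenClass 𝕜 m l j hj ≠ 0) :
    (∀ p, m k p = 0 ∨ m l p = 0) ∧
      ∀ p q, m k p ≠ 0 → m l q ≠ 0 → ∀ s,
        ¬ m s ≤ (m k - Finsupp.single p 1) + (m l - Finsupp.single q 1) := by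
  have key : ∀ p q, m k p ≠ 0 → m l q ≠ 0 → koszulGen 𝕜 m k p * koszulGen 𝕜 m l q ≠ 0 := by
    intro p q hp hq h0
    apply h
    rw [koszulGenClass_eq hp hi, koszulGenClass_eq hq hj, koszulGenClass_mul_eq_zero_iff]
    exact ⟨0, by rw [map_zero, h0]⟩
  constructor
  · intro p
    by_contra! hp
    exact key p p hp.1 hp.2 (ι_single_mul_ι_single_eq_zero (Or.inl rfl))
  · intro p q hp hq s hs
    refine key p q hp hq (ι_single_mul_ι_single_eq_zero (Or.inr ?_))
    rw [← map_mul, triMon_mul]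
    exact Ideal.Quotient.eq_zero_iff_mem.mpr (triMon_mem_monIdeal_iff.mpr ⟨s, hs⟩)

/-- If `m_k`, `m_l` are coprime and the product of the two classes vanishes, then some generator
divides `m_k m_l / (x_p x_q)` for suitable `x_p ∣ m_k` and `x_q ∣ m_l`. -/
theorem le_of_koszulGenClass_mul_eq_zero {k l : Fin n} {i j : Fin 3}
    (hi : m k i ≠ 0) (hj : m l j ≠ 0) (hdisj : ∀ p, m k p = 0 ∨ m l p = 0)
    (h : koszulGenClass 𝕜 m k i hi * koszulGenClass 𝕜 m l j hj = 0) :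
    ∃ p q s, m k p ≠ 0 ∧ m l q ≠ 0 ∧
      m s ≤ (m k - Finsupp.single p 1) + (m l - Finsupp.single q 1) := by
  obtain ⟨w, hw⟩ := (koszulGenClass_mul_eq_zero_iff hi hj).mp h
  have hij : i ≠ j := by
    rintro rfl
    have := hdisj i
    tauto
  have hthird : ∀ a b : Fin 3, ∃ r : Fin 3, a ≠ r ∧ b ≠ r := by decide
  obtain ⟨r, hir, hjr⟩ := hthird i j
  by_contra! hC
  set d := (m k - Finsupp.single i 1) + (m l - Finsupp.single j 1) with hd
  -- `g` is the coordinate of `w` at `e_j ∧ e_i ∧ e_r`, up to sign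
  obtain ⟨g, hg⟩ := Ideal.Quotient.mk_surjective (ExteriorAlgebra.algebraMapInv
    (coordContract r (coordContract j (coordContract i w))))
  have hinv : ∀ c : MonQuot 𝕜 m, ExteriorAlgebra.algebraMapInv
      (algebraMap _ (ExteriorAlgebra (MonQuot 𝕜 m) (Fin 3 → MonQuot 𝕜 m)) c) = c :=
    ExteriorAlgebra.algebraMap_leftInverse _
  have coord : ∀ p q t : Fin 3, p ≠ q → p ≠ t → q ≠ t →
      quotVars 𝕜 m t * ExteriorAlgebra.algebraMapInv
        (coordContract t (coordContract p (coordContract q w))) =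
      ExteriorAlgebra.algebraMapInv
        (coordContract p (coordContract q (koszulGen 𝕜 m k i * koszulGen 𝕜 m l j))) := by
    intro p q t hpq hpt hqt
    rw [← hw, coordContract_coordContract_koszulD _ hpq hpt hqt, map_smul, smul_eq_mul]
  have e1 : MvPolynomial.X r * g - triMon 𝕜 d ∈ monIdeal 𝕜 m := by
    rw [← Ideal.Quotient.eq, map_mul, hg]
    refine (coord j i r hij.symm hjr hir).trans ?_
    rw [koszulGen, koszulGen, coordContract_coordContract_ι_mul_ι, hinv]
    simp [hij, hij.symm, hd, ← triMon_mul]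
  have e2 : MvPolynomial.X i * g ∈ monIdeal 𝕜 m := by
    rw [← Ideal.Quotient.eq_zero_iff_mem, map_mul, hg]
    have hperm : coordContract r (coordContract j (coordContract i w)) =
        coordContract i (coordContract r (coordContract j w)) := by
      rw [coordContract_comm j i, map_neg, coordContract_comm r i, neg_neg]
    rw [hperm]
    refine (coord r j i hjr.symm hir.symm hij.symm).trans ?_
    rw [koszulGen, koszulGen, coordContract_coordContract_ι_mul_ι, hinv]
    simp [hij.symm, hir.symm, hjr.symm]
  have e3 : MvPolynomial.X j * g ∈ monIdeal 𝕜 m := by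
    rw [← Ideal.Quotient.eq_zero_iff_mem, map_mul, hg]
    have hperm : coordContract r (coordContract j (coordContract i w)) =
        coordContract j (coordContract i (coordContract r w)) := by
      rw [coordContract_comm r j, coordContract_comm r i, map_neg, neg_neg]
    rw [hperm]
    refine (coord i r j hir hij hjr.symm).trans ?_
    rw [koszulGen, koszulGen, coordContract_coordContract_ι_mul_ι, hinv]
    simp [hij, hir.symm, hjr.symm]
  -- as `x ^ d ∉ I`, the monomial `x ^ d` occurs in `x_r g`
  have hcoeff : MvPolynomial.coeff d (MvPolynomial.X r * g) ≠ 0 := by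
    intro h0
    obtain ⟨s, hs⟩ := exists_le_of_mem_monIdeal e1 (d := d) (by
      rw [MvPolynomial.coeff_sub, h0]
      simp [triMon])
    exact hC i j s hi hj hs
  rw [MvPolynomial.coeff_X_mul'] at hcoeff
  split_ifs at hcoeff with hr
  swap
  · exact hcoeff rfl
  have hr' : m k r ≠ 0 ∨ m l r ≠ 0 := by
    simp only [hd, Finsupp.mem_support_iff, Finsupp.coe_add, Finsupp.coe_tsub, Pi.add_apply,
      Pi.sub_apply] at hr
    omega
  rcases hr' with hkr | hlr
  · obtain ⟨s, hs⟩ := exists_le_of_mem_monIdeal e2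
      (d := Finsupp.single i 1 + (d - Finsupp.single r 1)) (by
        rwa [MvPolynomial.coeff_X_mul])
    refine hC r j s hkr hj fun t => ?_
    have := hs t
    simp only [hd, Finsupp.coe_add, Finsupp.coe_tsub, Pi.add_apply, Pi.sub_apply,
      Finsupp.single_apply] at *
    split_ifs at * <;> subst_vars <;> omega
  · obtain ⟨s, hs⟩ := exists_le_of_mem_monIdeal e3
      (d := Finsupp.single j 1 + (d - Finsupp.single r 1)) (by
        rwa [MvPolynomial.coeff_X_mul])
    refine hC i r s hi hlr fun t => ?_
    have := hs t
    simp only [hd, Finsupp.coe_add, Finsupp.coe_tsub, Pi.add_apply, Pi.sub_apply,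
      Finsupp.single_apply] at *
    split_ifs at * <;> subst_vars <;> omega

end Product

/-! ### Second syzygies -/

section Syzygy

variable {𝕜 : Type*} [Field 𝕜] {n : ℕ} {m : Fin n → (Fin 3 →₀ ℕ)}

theorem syz_mem_secondSyzygies (k l : Fin n) : syz 𝕜 m k l ∈ secondSyzygies 𝕜 m := by
  rw [secondSyzygies, LinearMap.mem_ker, syz, map_sub, Fintype.linearCombination_apply_single,
    Fintype.linearCombination_apply_single, smul_eq_mul, smul_eq_mul, triMon_mul, triMon_mul,
    tsub_add_cancel_of_le le_sup_left, tsub_add_cancel_of_le le_sup_right, sub_self]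

theorem syz_apply_right {k l : Fin n} (hkl : k ≠ l) :
    syz 𝕜 m k l l = triMon 𝕜 (m k ⊔ m l - m l) := by
  simp [syz, hkl.symm]

theorem syz_apply_left {k l : Fin n} (hkl : k ≠ l) :
    syz 𝕜 m k l k = -triMon 𝕜 (m k ⊔ m l - m k) := by
  simp [syz, hkl]

/-- If the entry `lcm (m_k, m_l) / m_l` of `σ_{kl}` lies in `I`, then by minimality it is `m_k`. -/
theorem support_disjoint_of_syz_mem (hmin : IsMinimallyGenerating 𝕜 m) {k l : Fin n}
    (hkl : k ≠ l) (h : ∀ s, syz 𝕜 m k l s ≠ 0 → syz 𝕜 m k l s ∈ monIdeal 𝕜 m) (p : Fin 3) :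
    m k p = 0 ∨ m l p = 0 := by
  have hl := h l (by simp [syz_apply_right hkl, triMon])
  rw [syz_apply_right hkl, triMon_mem_monIdeal_iff] at hl
  obtain ⟨s, hs⟩ := hl
  have hsk : s = k := hmin.eq_of_le (hs.trans (by simp [tsub_le_iff_right]))
  subst hsk
  have := hs p
  simp only [Finsupp.coe_tsub, Pi.sub_apply, Finsupp.sup_apply] at this
  omega

theorem syz_mem_of_support_disjoint {k l : Fin n} (hdisj : ∀ p, m k p = 0 ∨ m l p = 0)
    (s : Fin n) : syz 𝕜 m k l s ∈ monIdeal 𝕜 m := by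
  have h1 : m k ≤ m k ⊔ m l - m l := fun p => by
    have := hdisj p
    simp only [Finsupp.coe_tsub, Pi.sub_apply, Finsupp.sup_apply]
    omega
  have h2 : m l ≤ m k ⊔ m l - m k := fun p => by
    have := hdisj p
    simp only [Finsupp.coe_tsub, Pi.sub_apply, Finsupp.sup_apply]
    omega
  refine Ideal.sub_mem _ ?_ ?_
  · rw [Pi.single_apply]
    split_ifs
    · exact triMon_mem_monIdeal_iff.mpr ⟨k, h1⟩
    · exact Ideal.zero_mem _
  · rw [Pi.single_apply]
    split_ifs
    · exact triMon_mem_monIdeal_iff.mpr ⟨l, h2⟩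
    · exact Ideal.zero_mem _

/-- If `m_s` divides `m_k m_l / (x_p x_q)` with `x_p ∣ m_k` and `x_q ∣ m_l`, where `m_k`, `m_l` are
coprime, then both `lcm (m_k, m_s)` and `lcm (m_s, m_l)` are proper divisors of `lcm (m_k, m_l)`,
and `σ_{kl} ∈ 𝔪 Z₂`. -/
theorem syz_mem_smul_secondSyzygies {k l s : Fin n} (hdisj : ∀ p, m k p = 0 ∨ m l p = 0)
    {p q : Fin 3} (hp : m k p ≠ 0) (hq : m l q ≠ 0)
    (hs : m s ≤ (m k - Finsupp.single p 1) + (m l - Finsupp.single q 1)) :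
    syz 𝕜 m k l ∈ homMaxIdeal 𝕜 • secondSyzygies 𝕜 m := by
  have hpt : ∀ t, m s t ≤ m k t ⊔ m l t := fun t => by
    have := hdisj t
    have := hs t
    simp only [Finsupp.coe_add, Finsupp.coe_tsub, Pi.add_apply, Pi.sub_apply] at this
    omega
  have e : syz 𝕜 m k l = triMon 𝕜 (m k ⊔ m l - m k ⊔ m s) • syz 𝕜 m k s +
      triMon 𝕜 (m k ⊔ m l - m s ⊔ m l) • syz 𝕜 m s l := by
    have c1 : (m k ⊔ m l - m k ⊔ m s) + (m k ⊔ m s - m s) =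
        (m k ⊔ m l - m s ⊔ m l) + (m s ⊔ m l - m s) := by
      ext t
      have := hpt t
      simp only [Finsupp.coe_add, Finsupp.coe_tsub, Pi.add_apply, Pi.sub_apply,
        Finsupp.sup_apply]
      omega
    have c2 : (m k ⊔ m l - m k ⊔ m s) + (m k ⊔ m s - m k) = m k ⊔ m l - m k := by
      ext t
      have := hpt t
      simp only [Finsupp.coe_add, Finsupp.coe_tsub, Pi.add_apply, Pi.sub_apply,
        Finsupp.sup_apply]
      omega
    have c3 : (m k ⊔ m l - m s ⊔ m l) + (m s ⊔ m l - m l) = m k ⊔ m l - m l := by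
      ext t
      have := hpt t
      simp only [Finsupp.coe_add, Finsupp.coe_tsub, Pi.add_apply, Pi.sub_apply,
        Finsupp.sup_apply]
      omega
    rw [syz, syz, syz, smul_sub, smul_sub, ← Pi.single_smul', ← Pi.single_smul',
      ← Pi.single_smul', ← Pi.single_smul']
    simp only [smul_eq_mul, triMon_mul, c1, c2, c3]
    abel
  rw [e]
  refine Submodule.add_mem _
    (Submodule.smul_mem_smul (triMon_mem_homMaxIdeal fun h0 => ?_) (syz_mem_secondSyzygies _ _))
    (Submodule.smul_mem_smul (triMon_mem_homMaxIdeal fun h0 => ?_) (syz_mem_secondSyzygies _ _))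
  · have h1 := DFunLike.congr_fun h0 q
    have h2 := hs q
    have := hdisj q
    simp only [Finsupp.coe_add, Finsupp.coe_tsub, Pi.add_apply, Pi.sub_apply,
      Finsupp.sup_apply, Finsupp.coe_zero, Pi.zero_apply, Finsupp.single_eq_same] at h1 h2
    omega
  · have h1 := DFunLike.congr_fun h0 p
    have h2 := hs p
    have := hdisj p
    simp only [Finsupp.coe_add, Finsupp.coe_tsub, Pi.add_apply, Pi.sub_apply,
      Finsupp.sup_apply, Finsupp.coe_zero, Pi.zero_apply, Finsupp.single_eq_same] at h1 h2
    omega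

/-- If `m_k`, `m_l` are coprime and the only generators dividing `m_k m_l`, then the coefficient of
`m_k` in the `l`-th coordinate vanishes on `𝔪 Z₂`. -/
theorem coeff_eq_zero_of_mem_smul {k l : Fin n} (hdisj : ∀ p, m k p = 0 ∨ m l p = 0)
    (hU : ∀ s, m s ≤ m k + m l → s = k ∨ s = l) {v : Fin n → TriPoly 𝕜}
    (hv : v ∈ homMaxIdeal 𝕜 • secondSyzygies 𝕜 m) : MvPolynomial.coeff (m k) (v l) = 0 := by
  induction hv using Submodule.smul_induction_on' with
  | smul a ha v hv =>
    -- in a relation `∑ v_s m_s = 0`, no proper divisor of `m_k` occurs in `v_l`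
    have key : ∀ d, d ≤ m k → d ≠ m k → MvPolynomial.coeff d (v l) = 0 := by
      intro d hd hne
      have hsum : ∑ s, v s * triMon 𝕜 (m s) = 0 := by
        have := LinearMap.mem_ker.mp hv
        simpa [Fintype.linearCombination_apply] using this
      have hc := congrArg (MvPolynomial.coeff (d + m l)) hsum
      rw [MvPolynomial.coeff_sum, Finset.sum_eq_single l] at hc
      · rw [triMon, MvPolynomial.coeff_mul_monomial, mul_one] at hc
        exact hc
      · intro s _ hsl
        rw [triMon, MvPolynomial.coeff_mul_monomial', if_neg]
        intro hs
        rcases hU s (hs.trans (add_le_add_left hd _)) with rfl | rfl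
        · refine hne (le_antisymm hd fun p => ?_)
          have := hs p
          have := hdisj p
          simp only [Finsupp.coe_add, Pi.add_apply] at *
          omega
        · exact hsl rfl
      · simp
    rw [Pi.smul_apply, smul_eq_mul, MvPolynomial.coeff_mul]
    refine Finset.sum_eq_zero fun x hx => ?_
    replace hx := Finset.HasAntidiagonal.mem_antidiagonal.mp hx
    by_cases h1 : x.1 = 0
    · rw [h1, coeff_zero_of_mem_homMaxIdeal ha, zero_mul]
    · rw [key x.2 (hx ▸ le_add_self) (fun h2 => h1 (by simpa [h2] using hx)), mul_zero]
  | add v _ w _ hv hw => rw [Pi.add_apply, MvPolynomial.coeff_add, hv, hw, add_zero]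

/-- If `m_k`, `m_l` are coprime and the only generators dividing `m_k m_l`, then `σ_{kl}` is an
ordered minimal second syzygy: no other `σ_{st}` contributes to the coefficient of `m_k` in the
`l`-th coordinate. -/
theorem isOrderedMinimalSyzygy_of_not_le {k l : Fin n} (hkl : k < l)
    (hdisj : ∀ p, m k p = 0 ∨ m l p = 0) (hU : ∀ s, m s ≤ m k + m l → s = k ∨ s = l) :
    IsOrderedMinimalSyzygy 𝕜 m k l := by
  have hsup : m k ⊔ m l - m l = m k := by
    ext p
    have := hdisj p
    simp only [Finsupp.coe_tsub, Pi.sub_apply, Finsupp.sup_apply]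
    omega
  have hne : MvPolynomial.coeff (m k) (syz 𝕜 m k l l) ≠ 0 := by
    rw [syz_apply_right hkl.ne, hsup, triMon, MvPolynomial.coeff_monomial, if_pos rfl]
    exact one_ne_zero
  refine ⟨syz_mem_secondSyzygies k l, fun h => hne (coeff_eq_zero_of_mem_smul hdisj hU h), ?_⟩
  rintro ⟨a, ha, hunit⟩
  -- a multiple of the entry `lcm (m_s, m_l) / m_l` involves `m_k` only if `m_s ∣ m_k m_l`
  have hzero : ∀ (b : TriPoly 𝕜) (s : Fin n), s ≠ k → s ≠ l →
      MvPolynomial.coeff (m k) (b * triMon 𝕜 (m s ⊔ m l - m l)) = 0 := by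
    intro b s hsk hsl
    rw [triMon, MvPolynomial.coeff_mul_monomial', if_neg]
    intro hle
    rcases hU s (le_sup_left.trans (tsub_le_iff_right.mp hle)) with h | h
    · exact hsk h
    · exact hsl h
  apply hne
  rw [ha, Finset.sum_apply, MvPolynomial.coeff_sum]
  refine Finset.sum_eq_zero fun s _ => ?_
  rw [Finset.sum_apply, MvPolynomial.coeff_sum]
  refine Finset.sum_eq_zero fun t ht => ?_
  have hst : s < t := Finset.mem_Ioi.mp ht
  by_cases hmem : a s t ∈ homMaxIdeal 𝕜
  · exact coeff_eq_zero_of_mem_smul hdisj hU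
      (Submodule.smul_mem_smul hmem (syz_mem_secondSyzygies s t))
  have hlt := hunit s t hst hmem
  rw [Pi.smul_apply, smul_eq_mul]
  by_cases htl : t = l
  · subst htl
    rw [syz_apply_right hst.ne]
    refine hzero _ s ?_ hst.ne
    rintro rfl
    exact hlt.elim (lt_irrefl _) fun h => lt_irrefl _ h.2
  by_cases hsl : s = l
  · subst hsl
    rw [syz_apply_left hst.ne, mul_neg, MvPolynomial.coeff_neg, sup_comm,
      hzero _ t (hkl.trans hst).ne' hst.ne', neg_zero]
  · simp [syz, Ne.symm htl, Ne.symm hsl]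

end Syzygy

end

/-! ### Nonzero products and ordered minimal syzygies -/

theorem theorem3p3 (𝕜 : Type*) [Field 𝕜] (n : ℕ) (m : Fin n → (Fin 3 →₀ ℕ))
    (hmin : IsMinimallyGenerating 𝕜 m)
    (hprim : (monIdeal 𝕜 m).IsPrimary) (hrad : (monIdeal 𝕜 m).radical = homMaxIdeal 𝕜)
    (k l : Fin n) (hkl : k < l) (i j : Fin 3) (hki : m k i ≠ 0) (hlj : m l j ≠ 0)
    (hgk : IsMinimalGenerator (koszulHomologyDegree (quotVars 𝕜 m) 1)
      (koszulGenClass 𝕜 m k i hki))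
    (hgl : IsMinimalGenerator (koszulHomologyDegree (quotVars 𝕜 m) 1)
      (koszulGenClass 𝕜 m l j hlj)) :
    koszulGenClass 𝕜 m k i hki * koszulGenClass 𝕜 m l j hlj ≠ 0 ↔
      IsOrderedMinimalSyzygy 𝕜 m k l ∧
        ∀ s, syz 𝕜 m k l s ≠ 0 → syz 𝕜 m k l s ∈ monIdeal 𝕜 m := by
  constructor
  · intro h
    obtain ⟨hdisj, hC⟩ := support_disjoint_and_not_le_of_mul_ne_zero hki hlj h
    exact ⟨isOrderedMinimalSyzygy_of_not_le hkl hdisj fun s hs =>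
      eq_or_eq_of_le_add hmin hdisj hC hs, fun s _ => syz_mem_of_support_disjoint hdisj s⟩
  · rintro ⟨hσ, hI⟩ h0
    have hdisj := support_disjoint_of_syz_mem hmin hkl.ne hI
    obtain ⟨p, q, s, hp, hq, hs⟩ := le_of_koszulGenClass_mul_eq_zero hki hlj hdisj h0
    exact hσ.2.1 (syz_mem_smul_secondSyzygies hdisj hp hq hs)
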